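/- Let $K=SU_2$, let $\mathfrak k$ be its Lie algebra of trace-zero skew-Hermitian complex $2\times2$ matrices, with the bracket convention $[A,B]=BA-AB$ and the trace form $\langle A,B\rangle=-2\,\mathrm{Tr}(AB)$, and let $A_1=\frac12\begin{pmatrix} i&0\\0&-i\end{pmatrix}$. Fix $L>0$; all curves are smooth ($C^\infty$) on $[0,L]$. An anchored Darboux curve is a pair $(X,R)$ of smooth curves in $K$ with $X(0)=R(0)=I$ and $\frac{dX}{ds}=X\,RA_1R^*$ on $[0,L]$. It is called frame-periodic if $R$ is smoothly closed, i.e. $R$ is the restriction to $[0,L]$ of a smooth $L$-periodic map on $\mathbb R$. Let $\mathrm{Horiz}(\mathcal D_s)(L)$ (respectively $\mathrm{Horiz}(\mathcal{PD}_s)(L)$) be the set of the projections $X$ of all anchored Darboux curves (respectively of the frame-periodic ones). The tangent space at $X$ of either of these sets $\mathcal M$ is the set of all $v(s)=\frac{\partial Y}{\partial t}(s,0)$, where $Y(s,t)$ is smooth on $[0,L]\times(-\varepsilon,\varepsilon)$ for some $\varepsilon>0$, $Y(\cdot,t)\in\mathcal M$ for each $t$, and $Y(\cdot,0)=X$. (a)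 Let $X\in\mathrm{Horiz}(\mathcal D_s)(L)$ and let $\Lambda$ be defined by $\frac{dX}{ds}(s)=X(s)\Lambda(s)$. The tangent space $T_X\,\mathrm{Horiz}(\mathcal D_s)(L)$ consists exactly of the curves $v(s)=X(s)V(s)$, where $V$ is a smooth curve in $\mathfrak k$ that solves $$\frac{dV}{ds}(s)=[\Lambda(s),V(s)]+U(s),\qquad V(0)=0,$$ for some smooth curve $U$ in $\mathfrak k$ with $U(0)=0$ and $\langle\Lambda(s),U(s)\rangle=0$ for all $s\in[0,L]$. (b) Let $X\in\mathrm{Horiz}(\mathcal{PD}_s)(L)$, with $\Lambda$ as in (a). The tangent space $T_X\,\mathrm{Horiz}(\mathcal{PD}_s)(L)$ consists exactly of the curves $v(s)=X(s)V(s)$ with $V$ and $U$ as in (a) for which, in addition, $U$ is smoothly periodic with period $L$, i.e. $U$ is the restriction to $[0,L]$ of a smooth $L$-periodic map on $\mathbb R$. -/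

import Mathlib

open Set Matrix
open scoped ContDiff Matrix.Norms.Operator

/-! Curves on `[0, L]` are represented by functions on `ℝ` of which only the values on
`Icc 0 L` matter; all conditions below depend only on these values. Smoothness and derivatives
on `Icc 0 L` are one-sided at the end points. -/

namespace SphericalDarboux

/-- Complex `2 × 2` matrices. The norm (needed only to speak of smoothness) is immaterial, since
the space is finite-dimensional. -/
abbrev M2 := Matrix (Fin 2) (Fin 2) ℂ

/-- The group `K = SU(2)`, i.e. the sphere `S³`, as a set of matrices. -/
def K : Set M2 := {g | g ∈ Matrix.specialUnitaryGroup (Fin 2) ℂ}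

/-- The Lie algebra `𝔨` of `K`: skew-Hermitian matrices of trace zero. -/
def k : Set M2 := {A | Aᴴ = -A ∧ A.trace = 0}

/-- The Pauli matrix `A₁ = ½ diag(i, -i)`, a unit vector for the trace form. -/
noncomputable def A₁ : M2 := !![Complex.I / 2, 0; 0, -(Complex.I / 2)]

/-- The trace form `⟨A, B⟩ = -2 Tr (A B)` (its values on `𝔨` are real). -/
noncomputable def traceForm (A B : M2) : ℂ := -2 * (A * B).trace

/-- The Lie bracket with the sign convention `[A, B] = B A - A B` (which is the opposite of
Mathlib's `⁅A, B⁆`). -/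
def bracket (A B : M2) : M2 := B * A - A * B

/-- `f` is a smooth curve on `[0, L]` with values in `S`. -/
def IsSmoothCurveIn (L : ℝ) (S : Set M2) (f : ℝ → M2) : Prop :=
  ContDiffOn ℝ ∞ f (Icc 0 L) ∧ ∀ s ∈ Icc 0 L, f s ∈ S

/-- The curve `f` on `[0, L]` is smoothly periodic with period `L`: it is the restriction of a
smooth `L`-periodic map on `ℝ`. -/
def IsSmoothlyPeriodic (L : ℝ) (f : ℝ → M2) : Prop :=
  ∃ F : ℝ → M2, ContDiff ℝ ∞ F ∧ Function.Periodic F L ∧ EqOn f F (Icc 0 L)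

/-- Anchored Darboux curves `(X, R)` in `K × K`: `X' = X Λ` with `Λ = R A₁ R*`, and
`X(0) = R(0) = I`. The frame at `X(s)` is `X(s) R(s) Aᵢ R(s)*`, `i = 1, 2, 3`. (The equation
`R' = R A` for some curve `A` in `𝔨` is automatic for a smooth curve `R` in `K`, with
`A = R* R'`.) -/
structure IsAnchoredDarboux (L : ℝ) (X R : ℝ → M2) : Prop where
  smooth_X : IsSmoothCurveIn L K X
  smooth_R : IsSmoothCurveIn L K R
  X_zero : X 0 = 1
  R_zero : R 0 = 1
  deriv_X : ∀ s ∈ Icc 0 L, HasDerivWithinAt X (X s * (R s * A₁ * (R s)ᴴ)) (Icc 0 L) s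

/-- `Horiz(𝒟ₛ)(L)`: projections `X` of anchored Darboux curves `(X, R)`. -/
def HorizD (L : ℝ) : Set (ℝ → M2) :=
  {X | ∃ R, IsAnchoredDarboux L X R}

/-- `Horiz(𝒫𝒟ₛ)(L)`: projections `X` of frame-periodic anchored Darboux curves, i.e. those with
`R` a smoothly closed curve. -/
def HorizPD (L : ℝ) : Set (ℝ → M2) :=
  {X | ∃ R, IsAnchoredDarboux L X R ∧ IsSmoothlyPeriodic L R}

/-- The tangent space at `X` of a space `C` of curves on `[0, L]`: the velocities
`v(s) = ∂Y/∂t (s, 0)` of the smooth curves `t ↦ Y t` in `C`, defined for `t` near `0`, with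
`Y 0 = X`. A curve `t ↦ Y t` in the Fréchet space of smooth maps on the compact interval `[0, L]`
is smooth exactly when `(t, s) ↦ Y t s` is jointly smooth. -/
def tangentSpace (L : ℝ) (C : Set (ℝ → M2)) (X : ℝ → M2) : Set (ℝ → M2) :=
  {v | ∃ ε > 0, ∃ Y : ℝ → ℝ → M2,
    ContDiffOn ℝ ∞ (fun p : ℝ × ℝ => Y p.1 p.2) (Ioo (-ε) ε ×ˢ Icc 0 L) ∧
    (∀ t ∈ Ioo (-ε) ε, Y t ∈ C) ∧
    EqOn (Y 0) X (Icc 0 L) ∧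
    ∀ s ∈ Icc 0 L, HasDerivAt (fun t => Y t s) (v s) 0}

end SphericalDarboux

/-! From a family `Y t` to the linearized equation: put `lam = Yᴴ ∂ₛY = R A₁ Rᴴ`. It is jointly
smooth because `Y` is, even if the frames `R t` are chosen without regard to `t`. With `U = ∂ₜ lam`
at `t = 0` and `V = Xᴴ v`, equality of mixed partials gives `V' = [Λ, V] + U`. The anchoring gives
`V 0 = U 0 = 0`, and differentiating `lam² = -1/4` gives `ΛU + UΛ = 0`, hence orthogonality. If
every `R t` is periodic, all `s`-derivatives of `lam` match at the two ends for every `t`;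
differentiating in `t` shows that those of `U` match too, so `U` is smoothly periodic. This is
`exists_linearized_of_family`.

Conversely, orthogonality puts `W = 2ΛU` in the Lie algebra, and the frames `exp(tW) R` rotate `Λ`
with initial velocity `WΛ - ΛW = U`. Solving `Y' = Y exp(tW) Λ exp(-tW)` gives anchored Darboux
curves, frame-periodic if `R` and `U` are periodic. By the first direction their velocity solves the
linearized equation with this same `U`, so uniqueness identifies it with `X V`. This is
`exists_family_of_linearized`.

The analytic input is joint smoothness of `Y` in `(t, s)` up to the ends of `[0, L]`. It comes from
rescaling time to `[0, 1]` and inverting `1 - volterra A`, an operation smooth in the coefficient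
`A` of the Banach algebra `C([0,1], E)`. -/

/-- `1 - x` is a factor of `1 - x ^ n` that commutes with its cofactor. A Volterra operator may have
large norm, but some power of it is a contraction. -/
theorem isUnit_one_sub_of_isUnit_one_sub_pow {R : Type*} [Ring R] {x : R} {n : ℕ}
    (h : IsUnit (1 - x ^ n)) : IsUnit (1 - x) := by
  have hcomm : Commute (1 - x) (∑ i ∈ Finset.range n, x ^ i) := by
    rw [Commute, SemiconjBy, mul_neg_geom_sum, geom_sum_mul_neg]
  rw [← mul_neg_geom_sum, hcomm.isUnit_mul_iff] at h
  exact h.1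

/-! ### Rescaling curves to the unit interval -/

section Rescale

variable {E : Type*} [NormedRing E]

/-- The curve `τ ↦ g (s τ)` on `[0, 1]`. -/
def rescale (g : C(ℝ, E)) (s : ℝ) : C(Icc (0 : ℝ) 1, E) :=
  ⟨fun τ => g (s * τ), by fun_prop⟩

@[simp] theorem rescale_apply (g : C(ℝ, E)) (s : ℝ) (τ : Icc (0 : ℝ) 1) :
    rescale g s τ = g (s * τ) := rfl

theorem continuous_rescale (g : C(ℝ, E)) : Continuous (rescale g) :=
  ContinuousMap.continuous_of_continuous_uncurry _
    (g.continuous.comp (continuous_fst.mul (continuous_subtype_val.comp continuous_snd)))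

/-- Extending by the end values keeps continuity only, so later smoothness claims remain on `[0,
L]`. -/
theorem exists_continuousMap_eqOn_Icc {L : ℝ} (hL : 0 ≤ L) {f : ℝ → E}
    (hf : ContinuousOn f (Icc 0 L)) : ∃ g : C(ℝ, E), EqOn g f (Icc 0 L) :=
  ⟨⟨IccExtend hL ((Icc 0 L).domRestrict f),
    (continuousOn_iff_continuous_domRestrict.1 hf).Icc_extend'⟩,
    fun _ hs => IccExtend_of_mem hL ((Icc 0 L).domRestrict f) hs⟩

end Rescale

/-! ### Volterra operators and smooth parameter dependence for linear equations -/

section Volterra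

open ContinuousMap

variable {E : Type*} [NormedRing E] [NormedAlgebra ℝ E] [CompleteSpace E]

/-- Integration from `0`, as a continuous linear operator on continuous curves on `[0, 1]`. -/
noncomputable def primitiveCLM (E : Type*) [NormedRing E] [NormedAlgebra ℝ E] [CompleteSpace E] :
    C(Icc (0 : ℝ) 1, E) →L[ℝ] C(Icc (0 : ℝ) 1, E) :=
  LinearMap.mkContinuous
    { toFun := fun y => ⟨fun τ => ∫ u in (0 : ℝ)..τ, y (projIcc 0 1 zero_le_one u), by
        have hc : Continuous fun u : ℝ => y (projIcc 0 1 zero_le_one u) :=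
          y.continuous.comp continuous_projIcc
        exact (intervalIntegral.continuous_primitive
          (fun a b => hc.intervalIntegrable a b) 0).comp continuous_subtype_val⟩
      map_add' := fun y z => by
        ext τ
        exact intervalIntegral.integral_add
          ((y.continuous.comp continuous_projIcc).intervalIntegrable _ _)
          ((z.continuous.comp continuous_projIcc).intervalIntegrable _ _)
      map_smul' := fun c y => by
        ext τ
        exact intervalIntegral.integral_smul c _ } 1 (fun y => by
    rw [one_mul, ContinuousMap.norm_le _ (norm_nonneg y)]
    intro τ
    refine (intervalIntegral.norm_integral_le_of_norm_le_const
      (C := ‖y‖) fun u _ => y.norm_coe_le_norm _).trans ?_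
    rw [sub_zero, abs_of_nonneg τ.2.1]
    exact mul_le_of_le_one_right (norm_nonneg y) τ.2.2)

/-- The Volterra operator `y ↦ ∫₀ y A`. -/
noncomputable def volterra (A : C(Icc (0 : ℝ) 1, E)) :
    C(Icc (0 : ℝ) 1, E) →L[ℝ] C(Icc (0 : ℝ) 1, E) :=
  (primitiveCLM E).comp ((ContinuousLinearMap.mul ℝ C(Icc (0 : ℝ) 1, E)).flip A)

theorem volterra_apply (A y : C(Icc (0 : ℝ) 1, E)) (τ : Icc (0 : ℝ) 1) :
    volterra A y τ = ∫ u in (0 : ℝ)..τ,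
      y (projIcc 0 1 zero_le_one u) * A (projIcc 0 1 zero_le_one u) := rfl

/-- The factor `τ ^ n / n!` is the volume of the simplex of the iterated integral; the factorial
makes high powers contractions. -/
theorem norm_volterra_pow_apply_le (A y : C(Icc (0 : ℝ) 1, E)) (n : ℕ) (τ : Icc (0 : ℝ) 1) :
    ‖(volterra A ^ n) y τ‖ ≤ (‖A‖ * τ) ^ n / n.factorial * ‖y‖ := by
  induction n generalizing τ with
  | zero => simpa using y.norm_coe_le_norm τ
  | succ n ih =>
    rw [pow_succ', mul_apply_eq_comp, volterra_apply]
    have hb : ∀ u ∈ Ioc (0 : ℝ) τ,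
        ‖(volterra A ^ n) y (projIcc 0 1 zero_le_one u) * A (projIcc 0 1 zero_le_one u)‖ ≤
          (‖A‖ ^ (n + 1) / n.factorial * ‖y‖) * u ^ n := by
      intro u hu
      have h := ih (projIcc 0 1 zero_le_one u)
      rw [projIcc_of_mem zero_le_one ⟨hu.1.le, hu.2.trans τ.2.2⟩] at h ⊢
      calc _ ≤ _ := norm_mul_le _ _
        _ ≤ ((‖A‖ * u) ^ n / n.factorial * ‖y‖) * ‖A‖ :=
            mul_le_mul h (A.norm_coe_le_norm _) (norm_nonneg _) ((norm_nonneg _).trans h)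
        _ = _ := by rw [mul_pow]; ring
    refine (intervalIntegral.norm_integral_le_of_norm_le τ.2.1
      (Filter.Eventually.of_forall hb) (by
        apply Continuous.intervalIntegrable; fun_prop)).trans (le_of_eq ?_)
    rw [intervalIntegral.integral_const_mul, integral_pow, Nat.factorial_succ]
    push_cast
    have := Nat.cast_add_one_ne_zero (R := ℝ) n
    have := Nat.cast_ne_zero (R := ℝ).2 n.factorial_ne_zero
    field_simp
    ring

theorem isUnit_one_sub_volterra (A : C(Icc (0 : ℝ) 1, E)) : IsUnit (1 - volterra A) := by
  obtain ⟨n, hn⟩ : ∃ n : ℕ, ‖A‖ ^ n / n.factorial < 1 :=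
    ((FloorSemiring.tendsto_pow_div_factorial_atTop ‖A‖).eventually_lt_const one_pos).exists
  have hle : ‖volterra A ^ n‖ < 1 := by
    refine lt_of_le_of_lt (ContinuousLinearMap.opNorm_le_bound _ (by positivity) fun y => ?_) hn
    rw [ContinuousMap.norm_le _ (by positivity)]
    intro τ
    refine (norm_volterra_pow_apply_le A y n τ).trans ?_
    have h : ‖A‖ * (τ : ℝ) ≤ ‖A‖ := mul_le_of_le_one_right (norm_nonneg A) τ.2.2
    have h0 : 0 ≤ ‖A‖ * (τ : ℝ) := mul_nonneg (norm_nonneg A) τ.2.1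
    gcongr
  have hu : IsUnit (1 - volterra A ^ n) := isUnit_one_sub_of_norm_lt_one (R := C(Icc (0 : ℝ) 1, E) →L[ℝ] C(Icc (0 : ℝ) 1, E)) hle
  exact isUnit_one_sub_of_isUnit_one_sub_pow (R := C(Icc (0 : ℝ) 1, E) →L[ℝ] C(Icc (0 : ℝ) 1, E)) hu

/-- The solution on `[0, 1]` of `y' = y A`, `y 0 = 1`. -/
noncomputable def propagator (A : C(Icc (0 : ℝ) 1, E)) : C(Icc (0 : ℝ) 1, E) :=
  Ring.inverse (1 - volterra A) 1

theorem propagator_eq (A : C(Icc (0 : ℝ) 1, E)) :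
    propagator A = 1 + volterra A (propagator A) := by
  have h := DFunLike.congr_fun (Ring.mul_inverse_cancel _ (isUnit_one_sub_volterra A)) 1
  rw [mul_apply_eq_comp, _root_.sub_apply] at h
  exact sub_eq_iff_eq_add.1 h

theorem eq_propagator {A y : C(Icc (0 : ℝ) 1, E)} (h : y = 1 + volterra A y) :
    y = propagator A := by
  have h' := DFunLike.congr_fun (Ring.inverse_mul_cancel _ (isUnit_one_sub_volterra A)) y
  rw [mul_apply_eq_comp, _root_.sub_apply] at h'
  have h1 : (1 : C(Icc (0 : ℝ) 1, E) →L[ℝ] C(Icc (0 : ℝ) 1, E)) y - volterra A y = 1 :=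
    sub_eq_iff_eq_add.2 h
  rw [h1] at h'
  exact h'.symm

/-- Inversion is smooth at units, and `1 - volterra A` is affine in `A`. -/
theorem contDiff_propagator : ContDiff ℝ ∞ (propagator : C(Icc (0 : ℝ) 1, E) → _) := by
  have hv : ContDiff ℝ ∞ fun A : C(Icc (0 : ℝ) 1, E) => 1 - volterra A :=
    contDiff_const.sub (contDiff_const.clm_comp (ContinuousLinearMap.contDiff _))
  have hi : ContDiff ℝ ∞ fun A : C(Icc (0 : ℝ) 1, E) => Ring.inverse (1 - volterra A) := by
    rw [contDiff_iff_contDiffAt]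
    intro A
    obtain ⟨u, hu⟩ := isUnit_one_sub_volterra A
    have h := contDiffAt_ringInverse ℝ (n := ∞)
      (R := C(Icc (0 : ℝ) 1, E) →L[ℝ] C(Icc (0 : ℝ) 1, E)) u
    rw [hu] at h
    exact h.comp A hv.contDiffAt
  exact hi.clm_apply contDiff_const

/-- The solution on `ℝ` of `y' = y g`, `y 0 = 1`. -/
noncomputable def linearFlow (g : C(ℝ, E)) (s : ℝ) : E :=
  propagator (s • rescale g s) ⟨1, zero_le_one, le_rfl⟩

theorem continuous_linearFlow (g : C(ℝ, E)) : Continuous (linearFlow g) :=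
  (ContinuousEvalConst.continuous_eval_const _).comp
    (contDiff_propagator.continuous.comp (continuous_id.smul (continuous_rescale g)))

/-- The curve `τ ↦ P (σ * τ)` solves the integral equation rescaled to `s * σ`, so uniqueness
applies. This glues the separate problems for each `s` into one solution on the line. -/
theorem linearFlow_mul (g : C(ℝ, E)) (s : ℝ) (σ : Icc (0 : ℝ) 1) :
    linearFlow g (s * σ) = propagator (s • rescale g s) σ := by
  set P := propagator (s • rescale g s) with hP
  let z : C(Icc (0 : ℝ) 1, E) := ⟨fun τ => P (σ * τ), by fun_prop⟩
  have hz : z = 1 + volterra ((s * σ) • rescale g (s * σ)) z := by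
    ext τ
    have h1 : P (σ * τ) = (1 + volterra (s • rescale g s) P) (σ * τ) := by
      rw [hP, ← propagator_eq]
    have h2 : z τ = P (σ * τ) := rfl
    rw [h2, h1, ContinuousMap.add_apply, ContinuousMap.add_apply, volterra_apply, volterra_apply]
    congr 1
    have h3 := intervalIntegral.smul_integral_comp_mul_left (a := 0) (b := (τ : ℝ))
      (fun u : ℝ => P (projIcc 0 1 zero_le_one u) *
        (s • rescale g s) (projIcc 0 1 zero_le_one u)) (σ : ℝ)
    rw [mul_zero] at h3
    have h4 : ((σ * τ : Icc (0 : ℝ) 1) : ℝ) = σ * τ := rfl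
    rw [h4, ← h3, ← intervalIntegral.integral_smul]
    refine intervalIntegral.integral_congr fun u hu => ?_
    rw [uIcc_of_le τ.2.1] at hu
    have hu' : u ∈ Icc (0 : ℝ) 1 := ⟨hu.1, hu.2.trans τ.2.2⟩
    have hσu : (σ : ℝ) * u ∈ Icc (0 : ℝ) 1 :=
      ⟨mul_nonneg σ.2.1 hu'.1, mul_le_one₀ σ.2.2 hu'.1 hu'.2⟩
    simp only [projIcc_of_mem zero_le_one hu', projIcc_of_mem zero_le_one hσu,
      ContinuousMap.smul_apply, rescale_apply]
    have h5 : z ⟨u, hu'⟩ = P ⟨σ * u, hσu⟩ := rfl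
    rw [h5, mul_smul_comm, mul_smul_comm, smul_smul, mul_comm (σ : ℝ) s, mul_assoc]
  have := eq_propagator hz
  rw [linearFlow, ← this]
  exact congrArg P (mul_one σ)

theorem linearFlow_eq (g : C(ℝ, E)) (s : ℝ) :
    linearFlow g s = 1 + ∫ u in (0 : ℝ)..s, linearFlow g u * g u := by
  conv_lhs => rw [linearFlow, propagator_eq, ContinuousMap.add_apply, volterra_apply]
  rw [ContinuousMap.one_apply]
  congr 1
  have h := intervalIntegral.smul_integral_comp_mul_left (a := 0) (b := (1 : ℝ))
      (fun u : ℝ => linearFlow g u * g u) s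
  rw [mul_zero, mul_one] at h
  rw [← h, ← intervalIntegral.integral_smul]
  refine intervalIntegral.integral_congr fun u hu => ?_
  rw [uIcc_of_le zero_le_one] at hu
  simp only [projIcc_of_mem zero_le_one hu, ContinuousMap.smul_apply, rescale_apply]
  rw [← linearFlow_mul g s ⟨u, hu⟩, mul_smul_comm]

theorem hasDerivAt_linearFlow (g : C(ℝ, E)) (s : ℝ) :
    HasDerivAt (linearFlow g) (linearFlow g s * g s) s := by
  have hc : Continuous fun u => linearFlow g u * g u :=
    (continuous_linearFlow g).mul g.continuous
  have h := (hc.integral_hasStrictDerivAt 0 s).hasDerivAt.const_add (1 : E)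
  exact h.congr_of_eventuallyEq (Filter.Eventually.of_forall (linearFlow_eq g))

theorem linearFlow_zero (g : C(ℝ, E)) : linearFlow g 0 = 1 := by
  rw [linearFlow_eq, intervalIntegral.integral_same, add_zero]

/-- The inclusion of `[0, 1]` into the algebra, as a continuous curve. -/
noncomputable def idCurve (E : Type*) [NormedRing E] [NormedAlgebra ℝ E] : C(Icc (0 : ℝ) 1, E) :=
  ⟨fun τ => algebraMap ℝ E τ, (continuous_algebraMap ℝ E).comp continuous_subtype_val⟩

theorem hasDerivWithinAt_rescale {L : ℝ} {g g' : C(ℝ, E)}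
    (hg : ∀ s ∈ Icc 0 L, HasDerivWithinAt g (g' s) (Icc 0 L) s) {s : ℝ} (hs : s ∈ Icc 0 L) :
    HasDerivWithinAt (rescale g) (idCurve E * rescale g' s) (Icc 0 L) s := by
  have hc : Continuous fun σ => idCurve E * rescale g' σ :=
    continuous_const.mul (continuous_rescale g')
  -- The primitive of the expected derivative `τ g'(sτ)` is differentiable in `C([0,1], E)`;
  -- evaluating at each `τ` identifies it with `rescale g` on `[0, L]`.
  have h := ((hc.integral_hasStrictDerivAt 0 s).hasDerivAt.const_add
    (rescale g 0)).hasDerivWithinAt (s := Icc 0 L)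
  refine h.congr_of_mem (fun x hx => ?_) hs
  ext τ
  have hint : (∫ σ in (0 : ℝ)..x, idCurve E * rescale g' σ) τ =
      ∫ σ in (0 : ℝ)..x, (idCurve E * rescale g' σ) τ :=
    ((ContinuousMap.evalCLM ℝ τ).intervalIntegral_comp_comm (hc.intervalIntegrable _ _)).symm
  rw [ContinuousMap.add_apply, hint]
  have hmem : ∀ σ ∈ Icc (0 : ℝ) x, σ * (τ : ℝ) ∈ Icc 0 L := fun σ hσ =>
    ⟨mul_nonneg hσ.1 τ.2.1, (mul_le_of_le_one_right hσ.1 τ.2.2).trans (hσ.2.trans hx.2)⟩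
  have hd : ∀ σ ∈ Icc (0 : ℝ) x, HasDerivWithinAt (fun σ : ℝ => g (σ * τ))
      ((idCurve E * rescale g' σ) τ) (Icc 0 x) σ := by
    intro σ hσ
    have h1 := (hg _ (hmem σ hσ)).scomp σ (h := fun σ : ℝ => σ * (τ : ℝ)) (s := Icc 0 x)
      (((hasDerivAt_id σ).mul_const (τ : ℝ)).hasDerivWithinAt) hmem
    rw [one_mul] at h1
    have h2 : (idCurve E * rescale g' σ) τ = (τ : ℝ) • g' (σ * τ) := (Algebra.smul_def _ _).symm
    rw [h2]
    exact h1
  have hftc := intervalIntegral.integral_eq_sub_of_hasDerivAt_of_le hx.1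
    (f := fun σ : ℝ => g (σ * τ)) (by fun_prop)
    (fun σ hσ => (hd σ ⟨hσ.1.le, hσ.2.le⟩).hasDerivAt (Icc_mem_nhds hσ.1 hσ.2))
    (((ContinuousEvalConst.continuous_eval_const τ).comp hc).intervalIntegrable _ _)
  rw [hftc]
  simp

theorem contDiffOn_rescale {L : ℝ} (hL : 0 < L) {g : C(ℝ, E)} (hg : ContDiffOn ℝ ∞ g (Icc 0 L)) :
    ContDiffOn ℝ ∞ (rescale g) (Icc 0 L) := by
  rw [contDiffOn_infty]
  intro n
  induction n generalizing g with
  | zero => exact contDiffOn_zero.2 (continuous_rescale g).continuousOn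
  | succ n ih =>
    have hu := uniqueDiffOn_Icc hL
    obtain ⟨hd, hd'⟩ := (contDiffOn_infty_iff_derivWithin hu).1 hg
    obtain ⟨g', hg'⟩ := exists_continuousMap_eqOn_Icc hL.le hd'.continuousOn
    have hder : ∀ s ∈ Icc 0 L, HasDerivWithinAt (rescale g) (idCurve E * rescale g' s)
        (Icc 0 L) s := fun s hs => hasDerivWithinAt_rescale (fun r hr => by
      rw [hg' hr]; exact (hd r hr).hasDerivWithinAt) hs
    push_cast
    rw [contDiffOn_succ_iff_derivWithin hu]
    refine ⟨fun s hs => (hder s hs).differentiableWithinAt, by simp, ?_⟩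
    exact (contDiffOn_const.mul (ih (hd'.congr hg'))).congr
      fun s hs => (hder s hs).derivWithin (hu s hs)

theorem contDiff_exp_of_complete : ContDiff ℝ ∞ (NormedSpace.exp : E → E) :=
  contDiff_iff_contDiffAt.2 fun x => (NormedSpace.exp_analytic (𝕂 := ℝ) x).contDiffAt

/-- Evaluation is a continuous ring homomorphism. Smoothness of `exp` on the Banach algebra of
curves can thus be used for pointwise exponentials. -/
theorem ContinuousMap.exp_apply {X : Type*} [TopologicalSpace X] [CompactSpace X] (f : C(X, E))
    (x : X) : NormedSpace.exp f x = NormedSpace.exp (f x) := by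
  let _ : NormedAlgebra ℚ E := NormedAlgebra.restrictScalars ℚ ℝ E
  let φ : C(X, E) →+* E :=
    { toFun := fun h => h x
      map_one' := rfl
      map_mul' := fun _ _ => rfl
      map_zero' := rfl
      map_add' := fun _ _ => rfl }
  exact NormedSpace.map_exp φ (ContinuousEvalConst.continuous_eval_const x) f

/-- Conjugating the coefficient of a linear differential equation by a smooth one-parameter family
yields solutions that depend smoothly on the parameter and on time together. -/
theorem exists_contDiffOn_solution_conj_exp {L : ℝ} (hL : 0 < L) {Λ W : ℝ → E}
    (hΛ : ContDiffOn ℝ ∞ Λ (Icc 0 L)) (hW : ContDiffOn ℝ ∞ W (Icc 0 L)) :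
    ∃ Y : ℝ → ℝ → E,
      ContDiffOn ℝ ∞ (fun p : ℝ × ℝ => Y p.1 p.2) (univ ×ˢ Icc 0 L) ∧
      (∀ t, Y t 0 = 1) ∧
      ∀ t, ∀ s ∈ Icc 0 L, HasDerivWithinAt (Y t)
        (Y t s * (NormedSpace.exp (t • W s) * Λ s * NormedSpace.exp (-(t • W s))))
        (Icc 0 L) s := by
  obtain ⟨g, hg⟩ := exists_continuousMap_eqOn_Icc hL.le hΛ.continuousOn
  obtain ⟨w, hw⟩ := exists_continuousMap_eqOn_Icc hL.le hW.continuousOn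
  have hexp : Continuous (NormedSpace.exp : E → E) := contDiff_exp_of_complete.continuous
  let a : ℝ → C(ℝ, E) := fun t =>
    ⟨fun s => NormedSpace.exp (t • w s) * g s * NormedSpace.exp (-(t • w s)), by fun_prop⟩
  have ha : ∀ t s, rescale (a t) s = NormedSpace.exp (t • rescale w s) * rescale g s *
      NormedSpace.exp (-(t • rescale w s)) := by
    intro t s
    ext τ
    simp [ContinuousMap.exp_apply, a]
  refine ⟨fun t => linearFlow (a t), ?_, fun t => linearFlow_zero _, fun t s hs => ?_⟩
  · have h2 : MapsTo (Prod.snd : ℝ × ℝ → ℝ) (univ ×ˢ Icc 0 L) (Icc 0 L) := fun p hp => hp.2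
    have hgs := (contDiffOn_rescale hL (hΛ.congr hg)).comp contDiff_snd.contDiffOn h2
    have hws := (contDiffOn_rescale hL (hW.congr hw)).comp contDiff_snd.contDiffOn h2
    have htw := contDiff_fst.contDiffOn.smul hws
    have he := contDiff_exp_of_complete.comp_contDiffOn htw
    have he' := contDiff_exp_of_complete.comp_contDiffOn htw.neg
    -- The rescaled coefficient is a smooth map of `(t, s)` into `C([0,1], E)`; `propagator` and
    -- evaluation at `1` preserve this.
    have hA := contDiff_snd.contDiffOn.smul ((he.mul hgs).mul he')
    have hev := (ContinuousMap.evalCLM (M := E) ℝ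
      (⟨1, zero_le_one, le_rfl⟩ : Icc (0 : ℝ) 1)).contDiff (n := ∞)
    refine ((hev.comp contDiff_propagator).comp_contDiffOn hA).congr fun p _ => ?_
    simp only [linearFlow, ha]
    rfl
  · have h := (hasDerivAt_linearFlow (a t) s).hasDerivWithinAt (s := Icc 0 L)
    rw [← hg hs, ← hw hs]
    exact h

end Volterra

/-! ### Algebra in the group and its Lie algebra, and linear equations there -/

namespace SphericalDarboux

theorem A₁_mem_k : A₁ ∈ k := by
  constructor
  · ext i j
    fin_cases i <;> fin_cases j <;> simp [A₁, Complex.ext_iff] <;> norm_num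
  · simp [A₁, Matrix.trace_fin_two]

theorem A₁_mul_self : A₁ * A₁ = -(1 / 4 : ℂ) • (1 : M2) := by
  ext i j
  fin_cases i <;> fin_cases j <;> simp [A₁, Matrix.mul_apply] <;>
    linear_combination (1 / 4) * Complex.I_mul_I

theorem mul_conjTranspose_of_mem_K {X : M2} (h : X ∈ K) : X * Xᴴ = 1 :=
  Matrix.mem_unitaryGroup_iff.1 (Matrix.mem_specialUnitaryGroup_iff.1 h).1

theorem conjTranspose_mul_of_mem_K {X : M2} (h : X ∈ K) : Xᴴ * X = 1 :=
  Matrix.mem_unitaryGroup_iff'.1 (Matrix.mem_specialUnitaryGroup_iff.1 h).1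

theorem mul_mem_K {X Y : M2} (hX : X ∈ K) (hY : Y ∈ K) : X * Y ∈ K :=
  (Matrix.specialUnitaryGroup (Fin 2) ℂ).mul_mem hX hY

theorem conj_mem_k {X A : M2} (hX : X ∈ K) (hA : A ∈ k) : X * A * Xᴴ ∈ k := by
  refine ⟨?_, ?_⟩
  · rw [conjTranspose_mul, conjTranspose_mul, conjTranspose_conjTranspose, hA.1]
    simp [mul_assoc]
  · rw [Matrix.trace_mul_comm, ← mul_assoc, conjTranspose_mul_of_mem_K hX, one_mul, hA.2]

theorem smul_mem_k (t : ℝ) {A : M2} (hA : A ∈ k) : t • A ∈ k := by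
  refine ⟨?_, ?_⟩
  · rw [conjTranspose_smul, hA.1, star_trivial, smul_neg]
  · rw [Matrix.trace_smul, hA.2, smul_zero]

theorem conj_A₁_mul_self {R : M2} (hR : R ∈ K) :
    (R * A₁ * Rᴴ) * (R * A₁ * Rᴴ) = -(1 / 4 : ℂ) • (1 : M2) := by
  calc _ = R * (A₁ * (Rᴴ * R) * A₁) * Rᴴ := by simp only [mul_assoc]
    _ = _ := by
      rw [conjTranspose_mul_of_mem_K hR, mul_one, A₁_mul_self, mul_smul_comm, mul_one,
        smul_mul_assoc, mul_conjTranspose_of_mem_K hR]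

/-- Polarized Cayley–Hamilton: trace-zero `2 × 2` matrices satisfy `AB + BA = Tr(AB) • 1`. -/
theorem anticommute_of_traceForm_eq_zero {A B : M2} (hA : A ∈ k) (hB : B ∈ k)
    (h : traceForm A B = 0) : A * B = -(B * A) := by
  have hA' := hA.2
  have hB' := hB.2
  simp only [traceForm, Matrix.trace_fin_two, Matrix.mul_apply, Fin.sum_univ_two] at h hA' hB'
  rw [eq_neg_iff_add_eq_zero]
  ext i j
  fin_cases i <;> fin_cases j <;>
    simp only [Matrix.add_apply, Matrix.mul_apply, Fin.sum_univ_two, Matrix.zero_apply,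
      Fin.zero_eta, Fin.mk_one]
  · linear_combination (-1 / 2) * h + A 0 0 * hB' - B 1 1 * hA'
  · linear_combination A 0 1 * hB' + B 0 1 * hA'
  · linear_combination A 1 0 * hB' + B 1 0 * hA'
  · linear_combination (-1 / 2) * h - A 0 0 * hB' + B 1 1 * hA'

theorem traceForm_eq_zero_of_anticommute {A B : M2} (h : A * B = -(B * A)) :
    traceForm A B = 0 := by
  have h1 := congrArg Matrix.trace h
  rw [Matrix.trace_neg, Matrix.trace_mul_comm B A] at h1
  rw [traceForm, self_eq_neg.1 h1, mul_zero]

theorem mul_mem_k_of_anticommute {A B : M2} (hA : A ∈ k) (hB : B ∈ k) (h : A * B = -(B * A))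
    (c : ℝ) : c • (A * B) ∈ k := by
  refine smul_mem_k c ⟨?_, ?_⟩
  · rw [conjTranspose_mul, hA.1, hB.1, neg_mul_neg, h, neg_neg]
  · have := traceForm_eq_zero_of_anticommute h
    simpa [traceForm] using this

theorem eq_of_hasDerivWithinAt_zero {L : ℝ} {f : ℝ → M2}
    (h : ∀ s ∈ Icc 0 L, HasDerivWithinAt f 0 (Icc 0 L) s) {s : ℝ} (hs : s ∈ Icc 0 L) :
    f s = f 0 :=
  constant_of_has_deriv_right_zero (fun r hr => (h r hr).continuousWithinAt)
    (fun r hr => (h r ⟨hr.1, hr.2.le⟩).mono_of_mem_nhdsWithin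
      (Icc_mem_nhdsGE_of_mem hr)) s hs

/-- The conjugate transpose as a real continuous linear map. -/
noncomputable def conjTransposeCLM : M2 →L[ℝ] M2 :=
  LinearMap.toContinuousLinearMap
    { toFun := fun A => Aᴴ
      map_add' := conjTranspose_add
      map_smul' := fun c A => by
        rw [conjTranspose_smul, star_trivial, RingHom.id_apply] }

theorem hasDerivWithinAt_conjTranspose {f : ℝ → M2} {f' : M2} {S : Set ℝ} {s : ℝ}
    (h : HasDerivWithinAt f f' S s) : HasDerivWithinAt (fun r => (f r)ᴴ) f'ᴴ S s :=
  conjTransposeCLM.hasFDerivAt.comp_hasDerivWithinAt s h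

theorem hasDerivWithinAt_entry {f : ℝ → M2} {f' : M2} {S : Set ℝ} {s : ℝ}
    (h : HasDerivWithinAt f f' S s) (i j : Fin 2) :
    HasDerivWithinAt (fun r => f r i j) (f' i j) S s :=
  (Matrix.entryLinearMap ℝ ℂ i j).toContinuousLinearMap.hasFDerivAt.comp_hasDerivWithinAt s h

theorem hasDerivWithinAt_det {f : ℝ → M2} {A : M2} {S : Set ℝ} {s : ℝ}
    (h : HasDerivWithinAt f (f s * A) S s) :
    HasDerivWithinAt (fun r => (f r).det) ((f s).det * A.trace) S s := by
  have h1 := ((hasDerivWithinAt_entry h 0 0).mul (hasDerivWithinAt_entry h 1 1)).sub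
    ((hasDerivWithinAt_entry h 0 1).mul (hasDerivWithinAt_entry h 1 0))
  have h2 : (fun r => (f r).det) = (((fun r => f r 0 0) * fun r => f r 1 1) -
      (fun r => f r 0 1) * fun r => f r 1 0) := funext fun r => Matrix.det_fin_two (f r)
  rw [h2]
  refine h1.congr_deriv ?_
  simp only [Matrix.det_fin_two, Matrix.trace_fin_two, Matrix.mul_apply, Fin.sum_univ_two]
  ring

/-- `Y Yᴴ` is constant as `Λ` is skew-Hermitian, and `det Y` is constant as `Λ` has trace zero. -/
theorem mem_K_of_hasDerivWithinAt {L : ℝ} {Y Λ : ℝ → M2} (hΛ : ∀ s ∈ Icc 0 L, Λ s ∈ k)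
    (hY : ∀ s ∈ Icc 0 L, HasDerivWithinAt Y (Y s * Λ s) (Icc 0 L) s) (h0 : Y 0 = 1)
    {s : ℝ} (hs : s ∈ Icc 0 L) : Y s ∈ K := by
  refine Matrix.mem_specialUnitaryGroup_iff.2 ⟨Matrix.mem_unitaryGroup_iff.2 ?_, ?_⟩
  · have h := eq_of_hasDerivWithinAt_zero (f := fun r => Y r * (Y r)ᴴ) (fun r hr => ?_) hs
    · simp only [h0, conjTranspose_one, mul_one] at h
      exact h
    · refine ((hY r hr).mul (hasDerivWithinAt_conjTranspose (hY r hr))).congr_deriv ?_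
      rw [conjTranspose_mul, (hΛ r hr).1]
      noncomm_ring
  · have h := eq_of_hasDerivWithinAt_zero (f := fun r => (Y r).det • (1 : M2)) (fun r hr => by
      refine ((hasDerivWithinAt_det (hY r hr)).smul_const (1 : M2)).congr_deriv ?_
      rw [(hΛ r hr).2, mul_zero, zero_smul]) hs
    simpa [h0] using congrArg (fun A : M2 => A 0 0) h

theorem eq_of_hasDerivWithinAt {L : ℝ} {P Q Λ : ℝ → M2} (hΛ : ∀ s ∈ Icc 0 L, Λ s ∈ k)
    (hP : ∀ s ∈ Icc 0 L, HasDerivWithinAt P (P s * Λ s) (Icc 0 L) s)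
    (hQ : ∀ s ∈ Icc 0 L, HasDerivWithinAt Q (Q s * Λ s) (Icc 0 L) s)
    (hP0 : P 0 = 1) (hQ0 : Q 0 = 1) {s : ℝ} (hs : s ∈ Icc 0 L) : P s = Q s := by
  have h := eq_of_hasDerivWithinAt_zero (f := fun r => P r * (Q r)ᴴ) (fun r hr => by
    refine ((hP r hr).mul (hasDerivWithinAt_conjTranspose (hQ r hr))).congr_deriv ?_
    rw [conjTranspose_mul, (hΛ r hr).1]
    noncomm_ring) hs
  simp only [hP0, hQ0, conjTranspose_one, mul_one] at h
  calc P s = P s * ((Q s)ᴴ * Q s) := by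
        rw [conjTranspose_mul_of_mem_K (mem_K_of_hasDerivWithinAt hΛ hQ hQ0 hs), mul_one]
    _ = Q s := by rw [← mul_assoc, h, one_mul]

/-- Uniqueness for the linearized equation `V' = [Λ, V] + U`. -/
theorem eq_of_hasDerivWithinAt_bracket {L : ℝ} {X V₁ V₂ U Λ : ℝ → M2}
    (hX : ∀ s ∈ Icc 0 L, HasDerivWithinAt X (X s * Λ s) (Icc 0 L) s)
    (hK : ∀ s ∈ Icc 0 L, X s ∈ K) (hΛ : ∀ s ∈ Icc 0 L, Λ s ∈ k)
    (h₁ : ∀ s ∈ Icc 0 L, HasDerivWithinAt V₁ (bracket (Λ s) (V₁ s) + U s) (Icc 0 L) s)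
    (h₂ : ∀ s ∈ Icc 0 L, HasDerivWithinAt V₂ (bracket (Λ s) (V₂ s) + U s) (Icc 0 L) s)
    (h0 : V₁ 0 = V₂ 0) {s : ℝ} (hs : s ∈ Icc 0 L) : V₁ s = V₂ s := by
  -- Conjugation by `X` cancels the bracket term, so the conjugated difference is constant.
  have h := eq_of_hasDerivWithinAt_zero (f := fun r => X r * (V₁ r - V₂ r) * (X r)ᴴ)
    (fun r hr => by
      refine (((hX r hr).mul ((h₁ r hr).sub (h₂ r hr))).mul
        (hasDerivWithinAt_conjTranspose (hX r hr))).congr_deriv ?_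
      rw [conjTranspose_mul, (hΛ r hr).1]
      simp only [bracket, Pi.sub_apply, Pi.mul_apply]
      noncomm_ring) hs
  simp only [h0, sub_self, mul_zero, zero_mul] at h
  have hc := conjTranspose_mul_of_mem_K (hK s hs)
  rw [← sub_eq_zero]
  calc V₁ s - V₂ s = ((X s)ᴴ * X s) * (V₁ s - V₂ s) * ((X s)ᴴ * X s) := by
        rw [hc, one_mul, mul_one]
    _ = (X s)ᴴ * (X s * (V₁ s - V₂ s) * (X s)ᴴ) * X s := by simp only [mul_assoc]
    _ = 0 := by rw [h, mul_zero, zero_mul]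

/-- A solution of the linearized equation with data in the Lie algebra stays in the Lie algebra. -/
theorem mem_k_of_hasDerivWithinAt_bracket {L : ℝ} {X V U Λ : ℝ → M2}
    (hX : ∀ s ∈ Icc 0 L, HasDerivWithinAt X (X s * Λ s) (Icc 0 L) s)
    (hK : ∀ s ∈ Icc 0 L, X s ∈ K) (hΛ : ∀ s ∈ Icc 0 L, Λ s ∈ k)
    (hU : ∀ s ∈ Icc 0 L, U s ∈ k)
    (hV : ∀ s ∈ Icc 0 L, HasDerivWithinAt V (bracket (Λ s) (V s) + U s) (Icc 0 L) s)
    (h0 : V 0 = 0) {s : ℝ} (hs : s ∈ Icc 0 L) : V s ∈ k := by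
  constructor
  · have h := eq_of_hasDerivWithinAt_bracket hX hK hΛ (V₁ := fun r => -(V r)ᴴ) (V₂ := V) (U := U)
      (fun r hr => by
        refine (hasDerivWithinAt_conjTranspose (hV r hr)).neg.congr_deriv ?_
        simp only [bracket, conjTranspose_add, conjTranspose_sub, conjTranspose_mul, (hΛ r hr).1,
          (hU r hr).1]
        noncomm_ring) hV (by simp [h0]) hs
    rw [← neg_eq_iff_eq_neg]
    exact h
  · have htr : ∀ r ∈ Icc 0 L, HasDerivWithinAt (fun r => (V r).trace • (1 : M2)) 0 (Icc 0 L) r := by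
      intro r hr
      have h := ((hasDerivWithinAt_entry (hV r hr) 0 0).add
        (hasDerivWithinAt_entry (hV r hr) 1 1)).smul_const (1 : M2)
      have hz : (bracket (Λ r) (V r) + U r) 0 0 + (bracket (Λ r) (V r) + U r) 1 1 = 0 := by
        rw [← Matrix.trace_fin_two, Matrix.trace_add, bracket, Matrix.trace_sub,
          Matrix.trace_mul_comm, sub_self, (hU r hr).2, add_zero]
      rw [hz, zero_smul] at h
      refine h.congr_of_mem (fun x _ => by rw [Matrix.trace_fin_two]; rfl) hr
    have h := eq_of_hasDerivWithinAt_zero htr hs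
    simpa [h0] using congrArg (fun A : M2 => A 0 0) h

theorem exp_mem_K {A : M2} (hA : A ∈ k) : NormedSpace.exp A ∈ K := by
  have h := mem_K_of_hasDerivWithinAt (L := 1) (Y := fun u => NormedSpace.exp (u • A))
    (Λ := fun _ => A) (fun _ _ => hA)
    (fun u _ => (hasDerivAt_exp_smul_const A u).hasDerivWithinAt) (by simp) ⟨zero_le_one, le_rfl⟩
  simpa using h

end SphericalDarboux

/-! ### Smooth periodic extension from matching end derivatives -/

section PeriodicExtension

/-- The `L`-periodic function that agrees with `f` on `[0, L)`. -/
noncomputable def periodicExtension {E : Type*} {L : ℝ} (hL : 0 < L) (f : ℝ → E) (s : ℝ) : E :=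
  f (toIcoMod hL 0 s)

theorem periodicExtension_periodic {E : Type*} {L : ℝ} (hL : 0 < L) (f : ℝ → E) :
    Function.Periodic (periodicExtension hL f) L := fun s => by
  rw [periodicExtension, toIcoMod_add_right, periodicExtension]

theorem periodicExtension_eqOn {E : Type*} {L : ℝ} (hL : 0 < L) {f : ℝ → E} (h : f 0 = f L) :
    EqOn (periodicExtension hL f) f (Icc 0 L) := by
  intro s hs
  rcases hs.2.eq_or_lt with rfl | hlt
  · have h1 := toIcoMod_apply_right hL 0
    rw [zero_add] at h1
    rw [periodicExtension, h1, h]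
  · rw [periodicExtension, (toIcoMod_eq_self hL).2 ⟨hs.1, by simpa using hlt⟩]

variable {E : Type*} [NormedAddCommGroup E] [NormedSpace ℝ E]

theorem hasDerivAt_periodicExtension {L : ℝ} (hL : 0 < L) {f f' : ℝ → E}
    (hf : ∀ s ∈ Icc 0 L, HasDerivWithinAt f (f' s) (Icc 0 L) s) (h : f 0 = f L)
    (h' : f' 0 = f' L) (s : ℝ) :
    HasDerivAt (periodicExtension hL f) (periodicExtension hL f' s) s := by
  have hper := periodicExtension_periodic hL f
  have hwithin : ∀ r ∈ Icc 0 L, HasDerivWithinAt (periodicExtension hL f) (f' r) (Icc 0 L) r :=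
    fun r hr => (hf r hr).congr_of_mem (periodicExtension_eqOn hL h) hr
  have hIco : ∀ r ∈ Ico 0 L, HasDerivAt (periodicExtension hL f) (f' r) r := by
    intro r hr
    rcases hr.1.eq_or_lt with rfl | hpos
    -- At the seam the left derivative is that at `L` moved by one period, and `h'` matches it with
    -- the right one.
    · have h1 := (hwithin 0 ⟨le_rfl, hL.le⟩).mono_of_mem_nhdsWithin (s := Ici 0)
        (Icc_mem_nhdsGE hL)
      have h2 := (hwithin L ⟨hL.le, le_rfl⟩).mono_of_mem_nhdsWithin (s := Iic L)
        (Icc_mem_nhdsLE hL)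
      have h3 : HasDerivWithinAt (fun x => periodicExtension hL f (x + L)) (f' L) (Iic 0) 0 := by
        have h4 := HasDerivWithinAt.scomp (h := fun x : ℝ => x + L) (h' := 1) (s := Iic 0) 0
          (by simpa using h2) ((hasDerivAt_id (0 : ℝ)).add_const L).hasDerivWithinAt
          (fun x hx => by simpa using hx)
        simpa [Function.comp_def] using h4
      simp only [hper _] at h3
      rw [← h'] at h3
      have h5 := h3.union h1
      rwa [Iic_union_Ici, hasDerivWithinAt_univ] at h5
    · exact (hwithin r ⟨hr.1, hr.2.le⟩).hasDerivAt (Icc_mem_nhds hpos hr.2)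
  have h6 := hIco _ (by simpa using toIcoMod_mem_Ico hL 0 s)
  have h7 : toIcoMod hL 0 s = s - toIcoDiv hL 0 s • L := rfl
  rw [h7] at h6
  have h8 := h6.comp_sub_const s (toIcoDiv hL 0 s • L)
  have h9 : ∀ x, periodicExtension hL f (x - toIcoDiv hL 0 s • L) = periodicExtension hL f x :=
    fun x => hper.sub_zsmul_eq _
  simp only [h9] at h8
  exact h8

/-- A curve on `[0, L]` whose derivatives of all orders match at the end points extends to a smooth
`L`-periodic map. -/
theorem contDiff_periodicExtension {L : ℝ} (hL : 0 < L) {u : ℕ → ℝ → E}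
    (hu : ∀ n, ∀ s ∈ Icc 0 L, HasDerivWithinAt (u n) (u (n + 1) s) (Icc 0 L) s)
    (h : ∀ n, u n 0 = u n L) : ContDiff ℝ ∞ (periodicExtension hL (u 0)) := by
  have hd := fun n => hasDerivAt_periodicExtension hL (hu n) (h n) (h (n + 1))
  rw [contDiff_infty]
  intro n
  suffices ∀ m, ContDiff ℝ n (periodicExtension hL (u m)) from this 0
  induction n with
  | zero =>
    exact fun m => contDiff_zero.2 (continuous_iff_continuousAt.2 fun s => (hd m s).continuousAt)
  | succ n ih =>
    intro m
    push_cast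
    rw [contDiff_succ_iff_deriv]
    refine ⟨fun s => (hd m s).differentiableAt, by simp, ?_⟩
    rw [show deriv (periodicExtension hL (u m)) = periodicExtension hL (u (m + 1)) from
      funext fun s => (hd m s).deriv]
    exact ih (m + 1)

end PeriodicExtension

/-! ### Partial derivatives on a strip that includes its edges -/

section PartialDerivatives

variable {E : Type*} [NormedAddCommGroup E] [NormedSpace ℝ E]

/-- The partial derivative in the first variable, within a set. -/
noncomputable def partialFst (Q : Set (ℝ × ℝ)) (G : ℝ × ℝ → E) (p : ℝ × ℝ) : E :=
  fderivWithin ℝ G Q p (1, 0)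

/-- The partial derivative in the second variable, within a set. -/
noncomputable def partialSnd (Q : Set (ℝ × ℝ)) (G : ℝ × ℝ → E) (p : ℝ × ℝ) : E :=
  fderivWithin ℝ G Q p (0, 1)

theorem ContDiffOn.partialFst {Q : Set (ℝ × ℝ)} {G : ℝ × ℝ → E} (hQ : UniqueDiffOn ℝ Q)
    (hG : ContDiffOn ℝ ∞ G Q) : ContDiffOn ℝ ∞ (partialFst Q G) Q :=
  (hG.fderivWithin hQ (m := ∞) (by simp)).clm_apply contDiffOn_const

theorem ContDiffOn.partialSnd {Q : Set (ℝ × ℝ)} {G : ℝ × ℝ → E} (hQ : UniqueDiffOn ℝ Q)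
    (hG : ContDiffOn ℝ ∞ G Q) : ContDiffOn ℝ ∞ (partialSnd Q G) Q :=
  (hG.fderivWithin hQ (m := ∞) (by simp)).clm_apply contDiffOn_const

/-- Symmetry of the second derivative holds at limits of interior points, so the edges `s = 0` and
`s = L` of the strip are covered. -/
theorem partialSnd_partialFst {Q : Set (ℝ × ℝ)} {G : ℝ × ℝ → E} (hQ : UniqueDiffOn ℝ Q)
    (hG : ContDiffOn ℝ ∞ G Q) {p : ℝ × ℝ} (hp : p ∈ Q) (hp' : p ∈ closure (interior Q)) :
    partialSnd Q (partialFst Q G) p = partialFst Q (partialSnd Q G) p := by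
  have hd : DifferentiableWithinAt ℝ (fderivWithin ℝ G Q) Q p :=
    (hG.fderivWithin hQ (m := ∞) (by simp)).differentiableOn (by simp) p hp
  have hs := (hG p hp).isSymmSndFDerivWithinAt
    (by rw [minSmoothness_of_isRCLikeNormedField]; exact WithTop.coe_le_coe.2 (le_top (a := (2 : ℕ∞)))) hQ hp' hp
  have h1 : ∀ v w : ℝ × ℝ, fderivWithin ℝ (fun q => fderivWithin ℝ G Q q v) Q p w =
      fderivWithin ℝ (fderivWithin ℝ G Q) Q p w v := by
    intro v w
    rw [fderivWithin_clm_apply (hQ p hp) hd (differentiableWithinAt_const v)]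
    simp
  change fderivWithin ℝ (fun q => fderivWithin ℝ G Q q (1, 0)) Q p (0, 1) =
    fderivWithin ℝ (fun q => fderivWithin ℝ G Q q (0, 1)) Q p (1, 0)
  rw [h1, h1]
  exact hs _ _

theorem hasDerivAt_partialFst {S T : Set ℝ} {G : ℝ × ℝ → E} {t s : ℝ}
    (hG : ContDiffOn ℝ ∞ G (S ×ˢ T)) (hS : S ∈ nhds t) (hs : s ∈ T) :
    HasDerivAt (fun r => G (r, s)) (partialFst (S ×ˢ T) G (t, s)) t := by
  have hd := (hG.differentiableOn (by simp) (t, s) ⟨mem_of_mem_nhds hS, hs⟩).hasFDerivWithinAt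
  have h := hd.comp_hasDerivWithinAt_of_eq (f := fun r : ℝ => (r, s)) (s := S) t
    ((hasDerivAt_id t).prodMk (hasDerivAt_const t s)).hasDerivWithinAt
    (fun r hr => ⟨hr, hs⟩) rfl
  exact h.hasDerivAt hS

theorem hasDerivWithinAt_partialSnd {S T : Set ℝ} {G : ℝ × ℝ → E} {t s : ℝ}
    (hG : ContDiffOn ℝ ∞ G (S ×ˢ T)) (ht : t ∈ S) (hs : s ∈ T) :
    HasDerivWithinAt (fun r => G (t, r)) (partialSnd (S ×ˢ T) G (t, s)) T s := by
  have hd := (hG.differentiableOn (by simp) (t, s) ⟨ht, hs⟩).hasFDerivWithinAt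
  exact hd.comp_hasDerivWithinAt_of_eq (f := fun r : ℝ => (t, r)) (s := T) s
    ((hasDerivAt_const s t).prodMk (hasDerivAt_id s)).hasDerivWithinAt
    (fun r hr => ⟨ht, hr⟩) rfl

theorem uniqueDiffOn_Ioo_prod_Icc {ε L : ℝ} (hL : 0 < L) :
    UniqueDiffOn ℝ (Ioo (-ε) ε ×ˢ Icc 0 L) :=
  (uniqueDiffOn_Ioo _ _).prod (uniqueDiffOn_Icc hL)

theorem subset_closure_interior_Ioo_prod_Icc {ε L : ℝ} (hL : 0 < L) :
    Ioo (-ε) ε ×ˢ Icc 0 L ⊆ closure (interior (Ioo (-ε) ε ×ˢ Icc 0 L)) := by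
  rw [interior_prod_eq, closure_prod_eq, isOpen_Ioo.interior_eq, interior_Icc,
    closure_Ioo hL.ne]
  exact prod_mono subset_closure subset_rfl

/-- If the curves `G (t, ·)` are smoothly periodic, so is the variation field. -/
theorem exists_periodic_partialFst {ε L : ℝ} (hε : 0 < ε) (hL : 0 < L) {G : ℝ × ℝ → E}
    (hG : ContDiffOn ℝ ∞ G (Ioo (-ε) ε ×ˢ Icc 0 L))
    (hper : ∀ t ∈ Ioo (-ε) ε, ∃ F : ℝ → E, ContDiff ℝ ∞ F ∧ Function.Periodic F L ∧
      EqOn (fun s => G (t, s)) F (Icc 0 L)) :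
    ∃ F : ℝ → E, ContDiff ℝ ∞ F ∧ Function.Periodic F L ∧
      EqOn (fun s => partialFst (Ioo (-ε) ε ×ˢ Icc 0 L) G (0, s)) F (Icc 0 L) := by
  set Q := Ioo (-ε) ε ×ˢ Icc 0 L
  have hQ : UniqueDiffOn ℝ Q := uniqueDiffOn_Ioo_prod_Icc hL
  have hI : Ioo (-ε) ε ∈ nhds (0 : ℝ) := Ioo_mem_nhds (neg_lt_zero.2 hε) hε
  have hI0 : (0 : ℝ) ∈ Ioo (-ε) ε := mem_of_mem_nhds hI
  let H : ℕ → ℝ × ℝ → E := fun n => (partialSnd Q)^[n] G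
  have hH : ∀ n, H (n + 1) = partialSnd Q (H n) := fun n => Function.iterate_succ_apply' _ _ _
  have hHs : ∀ n, ContDiffOn ℝ ∞ (H n) Q := by
    intro n
    induction n with
    | zero => exact hG
    | succ n ih => rw [hH]; exact ih.partialSnd hQ
  -- The periodic extensions need not depend smoothly on `t`; only this matching of end derivatives
  -- is retained from them.
  have hHper : ∀ n, ∀ t ∈ Ioo (-ε) ε, H n (t, 0) = H n (t, L) := by
    intro n t ht
    obtain ⟨F, hF, hFp, hFe⟩ := hper t ht
    have key : ∀ s ∈ Icc 0 L, H n (t, s) = iteratedDeriv n F s := by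
      induction n with
      | zero => intro s hs; rw [iteratedDeriv_zero]; exact hFe hs
      | succ n ih =>
        intro s hs
        rw [hH, iteratedDeriv_succ]
        have h1 := hasDerivWithinAt_partialSnd (hHs n) ht hs
        have h2 : HasDerivWithinAt (fun r => H n (t, r)) (deriv (iteratedDeriv n F) s)
            (Icc 0 L) s :=
          ((hF.differentiable_iteratedDeriv n (by exact_mod_cast WithTop.coe_lt_top _)
            s).hasDerivAt.hasDerivWithinAt).congr_of_mem ih hs
        exact (uniqueDiffOn_Icc hL s hs).eq_deriv _ h1 h2
    have hFn : Function.Periodic (iteratedDeriv n F) L := by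
      intro s
      rw [← congrFun (iteratedDeriv_comp_add_const n F L) s]
      exact congrArg (fun f => iteratedDeriv n f s) (funext hFp)
    rw [key 0 ⟨le_rfl, hL.le⟩, key L ⟨hL.le, le_rfl⟩]
    simpa using (hFn 0).symm
  let u : ℕ → ℝ → E := fun n s => partialFst Q (H n) (0, s)
  have hu : ∀ n, ∀ s ∈ Icc 0 L, HasDerivWithinAt (u n) (u (n + 1) s) (Icc 0 L) s := by
    intro n s hs
    have h1 := hasDerivWithinAt_partialSnd ((hHs n).partialFst hQ) hI0 hs
    have h2 := partialSnd_partialFst hQ (hHs n) (p := (0, s)) ⟨hI0, hs⟩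
      (subset_closure_interior_Ioo_prod_Icc hL ⟨hI0, hs⟩)
    rw [h2, ← hH] at h1
    exact h1
  have hends : ∀ n, u n 0 = u n L := by
    intro n
    have h1 := hasDerivAt_partialFst (hHs n) hI (s := 0) ⟨le_rfl, hL.le⟩
    have h2 := hasDerivAt_partialFst (hHs n) hI (s := L) ⟨hL.le, le_rfl⟩
    exact h1.unique (h2.congr_of_eventuallyEq (Filter.eventually_of_mem hI (hHper n)))
  exact ⟨periodicExtension hL (u 0), contDiff_periodicExtension hL hu hends,
    periodicExtension_periodic hL _, (periodicExtension_eqOn hL (hends 0)).symm⟩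

end PartialDerivatives

/-! ### The two inclusions for the tangent spaces -/

namespace SphericalDarboux

theorem contDiff_conjTranspose : ContDiff ℝ ∞ (fun A : M2 => Aᴴ) :=
  conjTransposeCLM.contDiff

theorem contDiff_exp_M2 : ContDiff ℝ ∞ (NormedSpace.exp : M2 → M2) :=
  contDiff_exp_of_complete

theorem IsSmoothlyPeriodic.const (L : ℝ) (A : M2) : IsSmoothlyPeriodic L fun _ => A :=
  ⟨fun _ => A, contDiff_const, fun _ => rfl, fun _ _ => rfl⟩

theorem IsSmoothlyPeriodic.mul {L : ℝ} {f g : ℝ → M2} (hf : IsSmoothlyPeriodic L f)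
    (hg : IsSmoothlyPeriodic L g) : IsSmoothlyPeriodic L fun s => f s * g s := by
  obtain ⟨F, hF, hFp, hFe⟩ := hf
  obtain ⟨G, hG, hGp, hGe⟩ := hg
  exact ⟨fun s => F s * G s, hF.mul hG, fun s => by simp only [hFp s, hGp s],
    fun s hs => by simp only [hFe hs, hGe hs]⟩

theorem IsSmoothlyPeriodic.comp {L : ℝ} {f : ℝ → M2} {φ : M2 → M2} (hφ : ContDiff ℝ ∞ φ)
    (hf : IsSmoothlyPeriodic L f) : IsSmoothlyPeriodic L fun s => φ (f s) := by
  obtain ⟨F, hF, hFp, hFe⟩ := hf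
  exact ⟨fun s => φ (F s), hφ.comp hF, fun s => by simp only [hFp s],
    fun s hs => by simp only [hFe hs]⟩

theorem IsSmoothlyPeriodic.conj_A₁ {L : ℝ} {R : ℝ → M2} (hR : IsSmoothlyPeriodic L R) :
    IsSmoothlyPeriodic L fun s => R s * A₁ * (R s)ᴴ :=
  (hR.mul (IsSmoothlyPeriodic.const L A₁)).mul (hR.comp contDiff_conjTranspose)

theorem contDiffOn_conj_A₁ {R : ℝ → M2} {S : Set ℝ} (hR : ContDiffOn ℝ ∞ R S) :
    ContDiffOn ℝ ∞ (fun s => R s * A₁ * (R s)ᴴ) S :=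
  (hR.mul contDiffOn_const).mul (contDiff_conjTranspose.comp_contDiffOn hR)

theorem mem_k_of_hasDerivAt {f : ℝ → M2} {A : M2} {t : ℝ} (hf : ∀ᶠ r in nhds t, f r ∈ k)
    (h : HasDerivAt f A t) : A ∈ k := by
  constructor
  · have h1 := (hasDerivWithinAt_conjTranspose h.hasDerivWithinAt (S := univ)).hasDerivAt
      Filter.univ_mem
    exact h1.unique (h.neg.congr_of_eventuallyEq (hf.mono fun r hr => hr.1))
  · have h1 := ((hasDerivWithinAt_entry h.hasDerivWithinAt (S := univ) 0 0).add
      (hasDerivWithinAt_entry h.hasDerivWithinAt (S := univ) 1 1)).hasDerivAt Filter.univ_mem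
    have h2 := h1.unique ((hasDerivAt_const t (0 : ℂ)).congr_of_eventuallyEq
      (hf.mono fun r hr => (Matrix.trace_fin_two (f r)).symm.trans hr.2))
    rw [Matrix.trace_fin_two, h2]

theorem IsAnchoredDarboux.conj_A₁_mem_k {L : ℝ} {X R : ℝ → M2} (h : IsAnchoredDarboux L X R)
    {s : ℝ} (hs : s ∈ Icc 0 L) : R s * A₁ * (R s)ᴴ ∈ k :=
  conj_mem_k (h.smooth_R.2 s hs) A₁_mem_k

theorem IsAnchoredDarboux.eq_conj_A₁ {L : ℝ} (hL : 0 < L) {X R : ℝ → M2}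
    (h : IsAnchoredDarboux L X R) {s : ℝ} (hs : s ∈ Icc 0 L) {A : M2}
    (hX : HasDerivWithinAt X (X s * A) (Icc 0 L) s) : A = R s * A₁ * (R s)ᴴ := by
  have h1 := (uniqueDiffOn_Icc hL s hs).eq_deriv _ hX (h.deriv_X s hs)
  have h2 := congrArg (fun B => (X s)ᴴ * B) h1
  simpa only [← mul_assoc, conjTranspose_mul_of_mem_K (h.smooth_X.2 s hs), one_mul] using h2

/-- The velocity of a smooth family of anchored Darboux curves solves the linearized equation. -/
theorem exists_linearized_of_family {L ε : ℝ} (hL : 0 < L) (hε : 0 < ε) {Y R : ℝ → ℝ → M2}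
    {X v Λ : ℝ → M2}
    (hY : ContDiffOn ℝ ∞ (fun p : ℝ × ℝ => Y p.1 p.2) (Ioo (-ε) ε ×ˢ Icc 0 L))
    (hA : ∀ t ∈ Ioo (-ε) ε, IsAnchoredDarboux L (Y t) (R t))
    (h0 : EqOn (Y 0) X (Icc 0 L))
    (hv : ∀ s ∈ Icc 0 L, HasDerivAt (fun t => Y t s) (v s) 0)
    (hX : ∀ s ∈ Icc 0 L, HasDerivWithinAt X (X s * Λ s) (Icc 0 L) s) :
    ∃ V U : ℝ → M2,
      (∀ s ∈ Icc 0 L, v s = X s * V s) ∧ IsSmoothCurveIn L k V ∧ IsSmoothCurveIn L k U ∧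
      (∀ s ∈ Icc 0 L, HasDerivWithinAt V (bracket (Λ s) (V s) + U s) (Icc 0 L) s) ∧
      V 0 = 0 ∧ U 0 = 0 ∧ (∀ s ∈ Icc 0 L, traceForm (Λ s) (U s) = 0) ∧
      (∀ s ∈ Icc 0 L, HasDerivAt (fun t => R t s * A₁ * (R t s)ᴴ) (U s) 0) ∧
      ((∀ t ∈ Ioo (-ε) ε, IsSmoothlyPeriodic L (R t)) → IsSmoothlyPeriodic L U) := by
  set Q := Ioo (-ε) ε ×ˢ Icc 0 L
  have hQ : UniqueDiffOn ℝ Q := uniqueDiffOn_Ioo_prod_Icc hL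
  have hI : Ioo (-ε) ε ∈ nhds (0 : ℝ) := Ioo_mem_nhds (neg_lt_zero.2 hε) hε
  have hI0 : (0 : ℝ) ∈ Ioo (-ε) ε := mem_of_mem_nhds hI
  have hz : (0 : ℝ) ∈ Icc 0 L := ⟨le_rfl, hL.le⟩
  set y : ℝ × ℝ → M2 := fun p => Y p.1 p.2
  have hysnd : ∀ t ∈ Ioo (-ε) ε, ∀ s ∈ Icc 0 L,
      partialSnd Q y (t, s) = Y t s * (R t s * A₁ * (R t s)ᴴ) := fun t ht s hs =>
    (uniqueDiffOn_Icc hL s hs).eq_deriv _ (hasDerivWithinAt_partialSnd hY ht hs)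
      ((hA t ht).deriv_X s hs)
  have hXK : ∀ s ∈ Icc 0 L, X s ∈ K := fun s hs => by
    rw [← h0 hs]; exact (hA 0 hI0).smooth_X.2 s hs
  have hΛ : ∀ s ∈ Icc 0 L, Λ s = R 0 s * A₁ * (R 0 s)ᴴ := fun s hs => by
    refine (hA 0 hI0).eq_conj_A₁ hL hs ?_
    rw [h0 hs]
    exact (hX s hs).congr_of_mem (fun r hr => h0 hr) hs
  have hΛk : ∀ s ∈ Icc 0 L, Λ s ∈ k := fun s hs => by
    rw [hΛ s hs]; exact (hA 0 hI0).conj_A₁_mem_k hs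
  -- Defined through `Y` alone, hence jointly smooth; `R t` need not vary smoothly with `t`.
  let lam : ℝ × ℝ → M2 := fun p => (y p)ᴴ * partialSnd Q y p
  have hlams : ContDiffOn ℝ ∞ lam Q :=
    (contDiff_conjTranspose.comp_contDiffOn hY).mul (hY.partialSnd hQ)
  have hlam : ∀ t ∈ Ioo (-ε) ε, ∀ s ∈ Icc 0 L, lam (t, s) = R t s * A₁ * (R t s)ᴴ := by
    intro t ht s hs
    change (Y t s)ᴴ * partialSnd Q y (t, s) = _
    rw [hysnd t ht s hs, ← mul_assoc,
      conjTranspose_mul_of_mem_K ((hA t ht).smooth_X.2 s hs), one_mul]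
  have hline : MapsTo (fun s : ℝ => ((0 : ℝ), s)) (Icc 0 L) Q := fun s hs => ⟨hI0, hs⟩
  have hlinec : ContDiffOn ℝ ∞ (fun s : ℝ => ((0 : ℝ), s)) (Icc 0 L) :=
    (contDiff_const.prodMk contDiff_id).contDiffOn
  have hvw : ∀ s ∈ Icc 0 L, v s = partialFst Q y (0, s) := fun s hs =>
    (hv s hs).unique (hasDerivAt_partialFst hY hI hs)
  have hvs : ContDiffOn ℝ ∞ v (Icc 0 L) := ((hY.partialFst hQ).comp hlinec hline).congr hvw
  have hXs : ContDiffOn ℝ ∞ X (Icc 0 L) := (hY.comp hlinec hline).congr fun s hs => (h0 hs).symm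
  set U : ℝ → M2 := fun s => partialFst Q lam (0, s)
  have hUd : ∀ s ∈ Icc 0 L, HasDerivAt (fun t => R t s * A₁ * (R t s)ᴴ) (U s) 0 := fun s hs =>
    (hasDerivAt_partialFst hlams hI hs).congr_of_eventuallyEq
      (Filter.eventually_of_mem hI fun t ht => (hlam t ht s hs).symm)
  have hUk : ∀ s ∈ Icc 0 L, U s ∈ k := fun s hs =>
    mem_k_of_hasDerivAt (Filter.eventually_of_mem hI fun t ht => (hA t ht).conj_A₁_mem_k hs)
      (hUd s hs)
  have hvd : ∀ s ∈ Icc 0 L, HasDerivWithinAt v (v s * Λ s + X s * U s) (Icc 0 L) s := by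
    intro s hs
    have h1 := hasDerivWithinAt_partialSnd (hY.partialFst hQ) hI0 hs
    -- Product rule for `∂ₜ(Y lam)`; swapping the partials turns it into the `s`-derivative of `v`.
    have h2 := (hasDerivAt_partialFst (hY.partialSnd hQ) hI hs).unique
      (((hv s hs).mul (hUd s hs)).congr_of_eventuallyEq
        (Filter.eventually_of_mem hI fun t ht => hysnd t ht s hs))
    rw [partialSnd_partialFst hQ hY ⟨hI0, hs⟩
      (subset_closure_interior_Ioo_prod_Icc hL ⟨hI0, hs⟩), h2, ← hΛ s hs, h0 hs] at h1
    exact h1.congr_of_mem hvw hs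
  have hVd : ∀ s ∈ Icc 0 L, HasDerivWithinAt (fun r => (X r)ᴴ * v r)
      (bracket (Λ s) ((X s)ᴴ * v s) + U s) (Icc 0 L) s := by
    intro s hs
    refine ((hasDerivWithinAt_conjTranspose (hX s hs)).mul (hvd s hs)).congr_deriv ?_
    rw [conjTranspose_mul, (hΛk s hs).1, mul_add, ← mul_assoc _ (X s) (U s),
      conjTranspose_mul_of_mem_K (hXK s hs), bracket]
    noncomm_ring
  have hv0 : v 0 = 0 := (hv 0 hz).unique ((hasDerivAt_const 0 (1 : M2)).congr_of_eventuallyEq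
    (Filter.eventually_of_mem hI fun t ht => (hA t ht).X_zero))
  have hU0 : U 0 = 0 := (hUd 0 hz).unique ((hasDerivAt_const 0 A₁).congr_of_eventuallyEq
    (Filter.eventually_of_mem hI fun t ht => by simp [(hA t ht).R_zero]))
  have hV0 : (X 0)ᴴ * v 0 = 0 := by rw [hv0, mul_zero]
  refine ⟨fun s => (X s)ᴴ * v s, U, fun s hs => ?_, ⟨?_, fun s hs => ?_⟩, ⟨?_, hUk⟩, hVd, hV0, hU0,
    fun s hs => ?_, hUd, fun hper => ?_⟩
  · rw [← mul_assoc, mul_conjTranspose_of_mem_K (hXK s hs), one_mul]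
  · exact (contDiff_conjTranspose.comp_contDiffOn hXs).mul hvs
  · exact mem_k_of_hasDerivWithinAt_bracket hX hXK hΛk hUk hVd hV0 hs
  · exact (hlams.partialFst hQ).comp hlinec hline
  -- The derivative of the constant `lam² = -1/4` is `UΛ + ΛU`, which therefore vanishes.
  · have h1 := ((hUd s hs).mul (hUd s hs)).unique
      ((hasDerivAt_const (0 : ℝ) (-(1 / 4 : ℂ) • (1 : M2))).congr_of_eventuallyEq
        (Filter.eventually_of_mem hI fun t ht => conj_A₁_mul_self ((hA t ht).smooth_R.2 s hs)))
    rw [← hΛ s hs, add_comm] at h1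
    exact traceForm_eq_zero_of_anticommute (eq_neg_of_add_eq_zero_left h1)
  · refine exists_periodic_partialFst hε hL hlams fun t ht => ?_
    obtain ⟨F, hF, hFp, hFe⟩ := (hper t ht).conj_A₁
    exact ⟨F, hF, hFp, fun s hs => (hlam t ht s hs).trans (hFe hs)⟩

/-- Every solution of the linearized equation is the velocity of a smooth family of anchored Darboux
curves. -/
theorem exists_family_of_linearized {L : ℝ} (hL : 0 < L) {X R Λ v V U : ℝ → M2}
    (hA : IsAnchoredDarboux L X R)
    (hX : ∀ s ∈ Icc 0 L, HasDerivWithinAt X (X s * Λ s) (Icc 0 L) s)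
    (hv : ∀ s ∈ Icc 0 L, v s = X s * V s) (hU : IsSmoothCurveIn L k U)
    (hV : ∀ s ∈ Icc 0 L, HasDerivWithinAt V (bracket (Λ s) (V s) + U s) (Icc 0 L) s)
    (hV0 : V 0 = 0) (hU0 : U 0 = 0) (hΛU : ∀ s ∈ Icc 0 L, traceForm (Λ s) (U s) = 0) :
    ∃ Y S : ℝ → ℝ → M2,
      ContDiffOn ℝ ∞ (fun p : ℝ × ℝ => Y p.1 p.2) (Ioo (-1) 1 ×ˢ Icc 0 L) ∧
      (∀ t, IsAnchoredDarboux L (Y t) (S t)) ∧ EqOn (Y 0) X (Icc 0 L) ∧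
      (∀ s ∈ Icc 0 L, HasDerivAt (fun t => Y t s) (v s) 0) ∧
      (IsSmoothlyPeriodic L R → IsSmoothlyPeriodic L U → ∀ t, IsSmoothlyPeriodic L (S t)) := by
  have hΛ : ∀ s ∈ Icc 0 L, Λ s = R s * A₁ * (R s)ᴴ := fun s hs => hA.eq_conj_A₁ hL hs (hX s hs)
  have hΛk : ∀ s ∈ Icc 0 L, Λ s ∈ k := fun s hs => by
    rw [hΛ s hs]; exact hA.conj_A₁_mem_k hs
  have hΛs : ContDiffOn ℝ ∞ Λ (Icc 0 L) := (contDiffOn_conj_A₁ hA.smooth_R.1).congr hΛ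
  have hanti : ∀ s ∈ Icc 0 L, Λ s * U s = -(U s * Λ s) := fun s hs =>
    anticommute_of_traceForm_eq_zero (hΛk s hs) (hU.2 s hs) (hΛU s hs)
  -- Chosen so that `WΛ - ΛW = U`: as `Λ² = -1/4` and `ΛU = -UΛ`, each of the two terms contributes
  -- `U / 2`.
  let W : ℝ → M2 := fun s => (2 : ℝ) • (Λ s * U s)
  have hWs : ContDiffOn ℝ ∞ W (Icc 0 L) := (hΛs.mul hU.1).const_smul (2 : ℝ)
  have hWk : ∀ s ∈ Icc 0 L, W s ∈ k := fun s hs =>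
    mul_mem_k_of_anticommute (hΛk s hs) (hU.2 s hs) (hanti s hs) 2
  let S : ℝ → ℝ → M2 := fun t s => NormedSpace.exp (t • W s) * R s
  have hS : ∀ t, ∀ s ∈ Icc 0 L, S t s * A₁ * (S t s)ᴴ =
      NormedSpace.exp (t • W s) * Λ s * NormedSpace.exp (-(t • W s)) := by
    intro t s hs
    rw [hΛ s hs, ← (smul_mem_k t (hWk s hs)).1, Matrix.exp_conjTranspose]
    simp only [S, conjTranspose_mul, mul_assoc]
  obtain ⟨Y, hYs, hY0, hYd⟩ := exists_contDiffOn_solution_conj_exp hL hΛs hWs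
  have hYd' : ∀ t, ∀ s ∈ Icc 0 L,
      HasDerivWithinAt (Y t) (Y t s * (S t s * A₁ * (S t s)ᴴ)) (Icc 0 L) s := fun t s hs => by
    rw [hS t s hs]; exact hYd t s hs
  have hSK : ∀ t, ∀ s ∈ Icc 0 L, S t s ∈ K := fun t s hs =>
    mul_mem_K (exp_mem_K (smul_mem_k t (hWk s hs))) (hA.smooth_R.2 s hs)
  have hSk : ∀ t, ∀ s ∈ Icc 0 L, S t s * A₁ * (S t s)ᴴ ∈ k := fun t s hs =>
    conj_mem_k (hSK t s hs) A₁_mem_k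
  have hYA : ∀ t, IsAnchoredDarboux L (Y t) (S t) := fun t =>
    { smooth_X := ⟨hYs.comp (contDiff_const.prodMk contDiff_id).contDiffOn
        fun s hs => ⟨mem_univ t, hs⟩, fun s hs => mem_K_of_hasDerivWithinAt (hSk t) (hYd' t)
          (hY0 t) hs⟩
      smooth_R := ⟨(contDiff_exp_M2.comp_contDiffOn (hWs.const_smul t)).mul hA.smooth_R.1, hSK t⟩
      X_zero := hY0 t
      R_zero := by simp [S, W, hU0, hA.R_zero]
      deriv_X := hYd' t }
  have hYX : EqOn (Y 0) X (Icc 0 L) := fun s hs => by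
    refine eq_of_hasDerivWithinAt hΛk (fun r hr => ?_) hX (hY0 0) hA.X_zero hs
    have h := hYd 0 r hr
    simp only [zero_smul, neg_zero, NormedSpace.exp_zero, one_mul, mul_one] at h
    exact h
  have hYs' := hYs.mono (prod_mono (subset_univ (Ioo (-1 : ℝ) 1)) (Subset.refl (Icc 0 L)))
  refine ⟨Y, S, hYs', hYA, hYX, fun s hs => ?_, fun hR hUp t => ?_⟩
  · have hI : Ioo (-1 : ℝ) 1 ∈ nhds (0 : ℝ) := Ioo_mem_nhds (by norm_num) one_pos
    have hw := fun r (hr : r ∈ Icc 0 L) => hasDerivAt_partialFst hYs' hI hr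
    -- The first direction, applied to the constructed family, reduces the velocity claim to `U' =
    -- U` and uniqueness.
    obtain ⟨V', U', hv', -, -, hV', hV0', -, -, hU', -⟩ :=
      exists_linearized_of_family hL one_pos hYs' (fun t _ => hYA t) hYX hw hX
    have hUU : ∀ r ∈ Icc 0 L, U' r = U r := by
      intro r hr
      have h1 := hU' r hr
      simp only [hS _ r hr, ← smul_neg] at h1
      have h2 := ((hasDerivAt_exp_smul_const (W r) (0 : ℝ)).mul_const (Λ r)).mul
        (hasDerivAt_exp_smul_const (-W r) (0 : ℝ))
      rw [h1.unique h2]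
      simp only [zero_smul, NormedSpace.exp_zero, one_mul, mul_one, W]
      have hsq : Λ r * Λ r = -(1 / 4 : ℂ) • (1 : M2) := by
        rw [hΛ r hr]; exact conj_A₁_mul_self (hA.smooth_R.2 r hr)
      have h3 : Λ r * U r * Λ r = (1 / 4 : ℂ) • U r := by
        rw [hanti r hr, neg_mul, mul_assoc, hsq, mul_smul_comm, mul_one, neg_smul, neg_neg]
      have h4 : Λ r * (Λ r * U r) = -(1 / 4 : ℂ) • U r := by
        rw [← mul_assoc, hsq, smul_mul_assoc, one_mul]
      rw [smul_mul_assoc, h3, mul_neg, mul_smul_comm, h4]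
      module
    have hVV := eq_of_hasDerivWithinAt_bracket hX hA.smooth_X.2 hΛk
      (fun r hr => by rw [← hUU r hr]; exact hV' r hr) hV (hV0'.trans hV0.symm) hs
    rw [hv s hs, ← hVV, ← hv' s hs]
    exact hw s hs
  · have hΛp : IsSmoothlyPeriodic L Λ := by
      obtain ⟨F, hF, hFp, hFe⟩ := hR.conj_A₁
      exact ⟨F, hF, hFp, fun s hs => (hΛ s hs).trans (hFe hs)⟩
    exact ((hΛp.mul hUp).comp (φ := fun A => NormedSpace.exp (t • (2 : ℝ) • A))
      (contDiff_exp_M2.comp ((contDiff_id.const_smul (2 : ℝ)).const_smul t))).mul hR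

end SphericalDarboux

theorem mainTheorem8 (L : ℝ) (hL : 0 < L) :
    (∀ X ∈ SphericalDarboux.HorizD L, ∀ Λ : ℝ → SphericalDarboux.M2,
      (∀ s ∈ Icc 0 L, HasDerivWithinAt X (X s * Λ s) (Icc 0 L) s) →
      SphericalDarboux.tangentSpace L (SphericalDarboux.HorizD L) X =
        {v | ∃ V U : ℝ → SphericalDarboux.M2,
          (∀ s ∈ Icc 0 L, v s = X s * V s) ∧
          SphericalDarboux.IsSmoothCurveIn L SphericalDarboux.k V ∧
          SphericalDarboux.IsSmoothCurveIn L SphericalDarboux.k U ∧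
          (∀ s ∈ Icc 0 L, HasDerivWithinAt V
            (SphericalDarboux.bracket (Λ s) (V s) + U s) (Icc 0 L) s) ∧
          V 0 = 0 ∧ U 0 = 0 ∧
          ∀ s ∈ Icc 0 L, SphericalDarboux.traceForm (Λ s) (U s) = 0}) ∧
    (∀ X ∈ SphericalDarboux.HorizPD L, ∀ Λ : ℝ → SphericalDarboux.M2,
      (∀ s ∈ Icc 0 L, HasDerivWithinAt X (X s * Λ s) (Icc 0 L) s) →
      SphericalDarboux.tangentSpace L (SphericalDarboux.HorizPD L) X =
        {v | ∃ V U : ℝ → SphericalDarboux.M2,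
          (∀ s ∈ Icc 0 L, v s = X s * V s) ∧
          SphericalDarboux.IsSmoothCurveIn L SphericalDarboux.k V ∧
          SphericalDarboux.IsSmoothCurveIn L SphericalDarboux.k U ∧
          (∀ s ∈ Icc 0 L, HasDerivWithinAt V
            (SphericalDarboux.bracket (Λ s) (V s) + U s) (Icc 0 L) s) ∧
          V 0 = 0 ∧ U 0 = 0 ∧
          (∀ s ∈ Icc 0 L, SphericalDarboux.traceForm (Λ s) (U s) = 0) ∧
          SphericalDarboux.IsSmoothlyPeriodic L U}) := by
  refine ⟨fun X hX Λ hΛ => ?_, fun X hX Λ hΛ => ?_⟩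
  · ext v
    constructor
    · rintro ⟨ε, hε, Y, hY, hYC, hY0, hv⟩
      -- Frames are picked independently for each `t`.
      choose! R hR using hYC
      obtain ⟨V, U, h1, h2, h3, h4, h5, h6, h7, -, -⟩ :=
        SphericalDarboux.exists_linearized_of_family hL hε hY hR hY0 hv hΛ
      exact ⟨V, U, h1, h2, h3, h4, h5, h6, h7⟩
    · rintro ⟨V, U, h1, -, h3, h4, h5, h6, h7⟩
      obtain ⟨R, hR⟩ := hX
      obtain ⟨Y, S, hYs, hYA, hYX, hv, -⟩ :=
        SphericalDarboux.exists_family_of_linearized hL hR hΛ h1 h3 h4 h5 h6 h7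
      exact ⟨1, one_pos, Y, hYs, fun t _ => ⟨S t, hYA t⟩, hYX, hv⟩
  · ext v
    constructor
    · rintro ⟨ε, hε, Y, hY, hYC, hY0, hv⟩
      choose! R hR using hYC
      obtain ⟨V, U, h1, h2, h3, h4, h5, h6, h7, -, h8⟩ :=
        SphericalDarboux.exists_linearized_of_family hL hε hY (fun t ht => (hR t ht).1) hY0 hv hΛ
      exact ⟨V, U, h1, h2, h3, h4, h5, h6, h7, h8 fun t ht => (hR t ht).2⟩
    · rintro ⟨V, U, h1, -, h3, h4, h5, h6, h7, hUp⟩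
      obtain ⟨R, hR, hRp⟩ := hX
      obtain ⟨Y, S, hYs, hYA, hYX, hv, hSp⟩ :=
        SphericalDarboux.exists_family_of_linearized hL hR hΛ h1 h3 h4 h5 h6 h7
      exact ⟨1, one_pos, Y, hYs, fun t _ => ⟨S t, hYA t, hSp hRp hUp t⟩, hYX, hv⟩
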